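/- Let $a>0$ and let $q:[-a,a]\to\mathbb{C}$ be continuous. Consider the Goursat problem \[ \frac{\partial^{2}H(u,v)}{\partial u\,\partial v}=q(u+v)H(u,v)\quad(|u|+|v|<a),\qquad H(u,0)=\frac12\int_0^u q(s)\,ds,\qquad H(0,v)=0\quad(|u|,|v|\le a), \] where a solution is a function $H$ that is continuous on $|u|+|v|\le a$, continuously differentiable on $|u|+|v|<a$, has there the mixed derivative $\partial_u(\partial_vH)$, and satisfies the equation and the boundary conditions. This problem has exactly one solution $H$ on $|u|+|v|\le a$. With this $H$ put, for $h\in\mathbb{C}$ and $|t|\le|x|\le a$, \[ K(x,t)=H\Big(\frac{x+t}{2},\frac{x-t}{2}\Big),\qquad \mathbf{K}(x,t;h)=\frac h2+K(x,t)+\frac h2\int_t^x\big(K(x,s)-K(x,-s)\big)\,ds, \] \[ \mathbf{T}_hv(x)=v(x)+\int_{-x}^{x}\mathbf{K}(x,t;h)\,v(t)\,dt\qquad(x\in[-a,a]). \] Then, for all $h,\omega\in\mathbb{C}$ and every solution $v\in C^2[-a,a]$ (complex-valued) of $v''+\omega^2v=0$ on $[-a,a]$, the function $u=\mathbf{T}_hv$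 belongs to $C^2[-a,a]$ and is the unique $C^2[-a,a]$ solution of \[ u''-q(x)u+\omega^2u=0\quad\text{on }[-a,a],\qquad u(0)=v(0),\qquad u'(0)=v'(0)+h\,v(0). \] -/

import Mathlib

open Set

noncomputable section

namespace Transmutation

/-- The closed square `|u| + |v| ≤ a`; in the variables `x = u + v`, `t = u - v` it is
`[-a, a] × [-a, a]`. -/
def closedDiamond (a : ℝ) : Set (ℝ × ℝ) := {p | |p.1| + |p.2| ≤ a}

/-- The open square `|u| + |v| < a`. -/
def openDiamond (a : ℝ) : Set (ℝ × ℝ) := {p | |p.1| + |p.2| < a}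

/-- `H` is a (classical) solution on `|u| + |v| ≤ a` of the Goursat problem
`∂²H/∂u∂v = q(u + v) H`, `H(u, 0) = (1/2) ∫₀ᵘ q(s) ds`, `H(0, v) = 0`. -/
structure IsGoursatSolution (a : ℝ) (q : ℝ → ℂ) (H : ℝ → ℝ → ℂ) : Prop where
  continuousOn : ContinuousOn (fun p : ℝ × ℝ => H p.1 p.2) (closedDiamond a)
  contDiffOn : ContDiffOn ℝ 1 (fun p : ℝ × ℝ => H p.1 p.2) (openDiamond a)
  mixed_deriv : ∀ u v : ℝ, |u| + |v| < a →
    HasDerivAt (fun u' : ℝ => deriv (fun v' : ℝ => H u' v') v) (q (u + v) * H u v) u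
  left_boundary : ∀ u ∈ Icc (-a) a, H u 0 = (1 / 2 : ℂ) * ∫ s in (0 : ℝ)..u, q s
  right_boundary : ∀ v ∈ Icc (-a) a, H 0 v = 0

/-- The solution `H` of the Goursat problem for the potential `q` on `[-a, a]`
(its values outside `|u| + |v| ≤ a` are immaterial). -/
def goursatH (a : ℝ) (q : ℝ → ℂ) : ℝ → ℝ → ℂ :=
  Classical.epsilon (IsGoursatSolution a q)

/-- `K(x, t) = H((x + t)/2, (x - t)/2)`. -/
def kernelK (a : ℝ) (q : ℝ → ℂ) (x t : ℝ) : ℂ :=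
  goursatH a q ((x + t) / 2) ((x - t) / 2)

/-- `𝐊(x, t; h) = h/2 + K(x, t) + (h/2) ∫ₜˣ (K(x, s) - K(x, -s)) ds`. -/
def kernelKh (a : ℝ) (q : ℝ → ℂ) (h : ℂ) (x t : ℝ) : ℂ :=
  h / 2 + kernelK a q x t
    + h / 2 * ∫ s in t..x, (kernelK a q x s - kernelK a q x (-s))

/-- The operator `𝐓_h u(x) = u(x) + ∫_{-x}^{x} 𝐊(x, t; h) u(t) dt`. -/
def opT (a : ℝ) (q : ℝ → ℂ) (h : ℂ) (u : ℝ → ℂ) (x : ℝ) : ℂ :=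
  u x + ∫ t in (-x)..x, kernelKh a q h x t * u t

/-- `u` is a `C²[-a, a]` solution of `u'' - q(x) u + ω² u = 0` on `[-a, a]`
(one-sided derivatives at the end points). -/
def IsSolution (a : ℝ) (q : ℝ → ℂ) (ω : ℂ) (u : ℝ → ℂ) : Prop :=
  ContDiffOn ℝ 2 u (Icc (-a) a) ∧
    ∀ x ∈ Icc (-a) a,
      iteratedDerivWithin 2 u (Icc (-a) a) x - q x * u x + ω ^ 2 * u x = 0

end Transmutation

end

namespace Transmutation

open Function MeasureTheory Topology Filter

/-! ### Functions of two real variables with continuous partial derivatives -/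

section Calculus

variable {f f₁ f₂ : ℝ → ℝ → ℂ}

theorem hasStrictFDerivAt_of_partial (h₁ : ∀ x y, HasDerivAt (fun x' => f x' y) (f₁ x y) x)
    (h₂ : ∀ x y, HasDerivAt (fun y' => f x y') (f₂ x y) y)
    (c₁ : Continuous (uncurry f₁)) (c₂ : Continuous (uncurry f₂)) (p : ℝ × ℝ) :
    HasStrictFDerivAt (fun p : ℝ × ℝ => f p.1 p.2)
      ((ContinuousLinearMap.toSpanSingleton ℝ (f₁ p.1 p.2)).coprod
        (ContinuousLinearMap.toSpanSingleton ℝ (f₂ p.1 p.2))) p := by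
  have k : ∀ {g : ℝ → ℝ → ℂ}, Continuous (uncurry g) →
      Continuous ↿(fun x y => ContinuousLinearMap.toSpanSingleton ℝ (g x y)) := fun hg =>
    (ContinuousLinearMap.toSpanSingletonCLE (𝕜 := ℝ) (E := ℂ)).continuous.comp hg
  exact hasStrictFDerivAt_uncurry_coprod (𝕜 := ℝ) (f := f)
    (f₁ := fun x y => ContinuousLinearMap.toSpanSingleton ℝ (f₁ x y))
    (f₂ := fun x y => ContinuousLinearMap.toSpanSingleton ℝ (f₂ x y))
    (Eventually.of_forall fun v => (h₁ v.1 v.2).hasFDerivAt)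
    (Eventually.of_forall fun v => (h₂ v.1 v.2).hasFDerivAt)
    (k c₁).continuousAt (k c₂).continuousAt

theorem contDiff_one_of_partial (h₁ : ∀ x y, HasDerivAt (fun x' => f x' y) (f₁ x y) x)
    (h₂ : ∀ x y, HasDerivAt (fun y' => f x y') (f₂ x y) y)
    (c₁ : Continuous (uncurry f₁)) (c₂ : Continuous (uncurry f₂)) :
    ContDiff ℝ 1 (fun p : ℝ × ℝ => f p.1 p.2) := by
  refine contDiff_one_iff_hasFDerivAt.2 ⟨_, ?_, fun p =>
    (hasStrictFDerivAt_of_partial h₁ h₂ c₁ c₂ p).hasFDerivAt⟩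
  have k : ∀ {g : ℝ → ℝ → ℂ}, Continuous (uncurry g) →
      Continuous (fun p : ℝ × ℝ => ContinuousLinearMap.toSpanSingleton ℝ (g p.1 p.2)) := fun hg =>
    (ContinuousLinearMap.toSpanSingletonCLE (𝕜 := ℝ) (E := ℂ)).continuous.comp hg
  have e : ∀ A B : ℝ →L[ℝ] ℂ, A.coprod B =
      A.comp (ContinuousLinearMap.fst ℝ ℝ ℝ) + B.comp (ContinuousLinearMap.snd ℝ ℝ ℝ) := by
    intro A B; ext <;> simp
  simp only [e]
  exact ((k c₁).clm_comp continuous_const).add ((k c₂).clm_comp continuous_const)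

theorem hasDerivAt_comp_of_partial (h₁ : ∀ x y, HasDerivAt (fun x' => f x' y) (f₁ x y) x)
    (h₂ : ∀ x y, HasDerivAt (fun y' => f x y') (f₂ x y) y)
    (c₁ : Continuous (uncurry f₁)) (c₂ : Continuous (uncurry f₂))
    {α β : ℝ → ℝ} {α' β' x : ℝ} (hα : HasDerivAt α α' x) (hβ : HasDerivAt β β' x) :
    HasDerivAt (fun x => f (α x) (β x)) (α' * f₁ (α x) (β x) + β' * f₂ (α x) (β x)) x := by
  have := (hasStrictFDerivAt_of_partial h₁ h₂ c₁ c₂ (α x, β x)).hasFDerivAt.comp_hasDerivAt x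
    (hα.prodMk hβ)
  simpa using! this

theorem hasDerivAt_integral_of_continuous (hf : Continuous (uncurry f))
    (hf₁ : Continuous (uncurry f₁)) (h₁ : ∀ x y, HasDerivAt (fun x' => f x' y) (f₁ x y) x)
    (a b x : ℝ) :
    HasDerivAt (fun x' => ∫ s in a..b, f x' s) (∫ s in a..b, f₁ x s) x := by
  have cf : ∀ x, Continuous (f x) := fun x => hf.comp (Continuous.prodMk_right x)
  have cf₁ : ∀ x, Continuous (f₁ x) := fun x => hf₁.comp (Continuous.prodMk_right x)
  obtain ⟨C, hC⟩ := ((isCompact_closedBall x 1).prod (isCompact_uIcc (a := a) (b := b))).bddAbove_image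
    (f := fun p : ℝ × ℝ => ‖f₁ p.1 p.2‖) hf₁.norm.continuousOn
  refine (intervalIntegral.hasDerivAt_integral_of_dominated_loc_of_deriv_le
    (F := f) (F' := f₁) (bound := fun _ => C) (Metric.closedBall_mem_nhds x one_pos)
    (Eventually.of_forall fun y => (cf y).aestronglyMeasurable)
    ((cf x).intervalIntegrable _ _) (cf₁ x).aestronglyMeasurable ?_ (by simp) ?_).2
  · exact Eventually.of_forall fun t ht y hy =>
      hC ⟨(y, t), ⟨hy, uIoc_subset_uIcc ht⟩, rfl⟩
  · exact Eventually.of_forall fun t _ y _ => h₁ y t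

theorem continuous_integral_left (hf : Continuous (uncurry f)) (a : ℝ) :
    Continuous (uncurry fun x y => ∫ s in a..y, f x s) :=
  intervalIntegral.continuous_parametric_intervalIntegral_of_continuous
    (f := fun p : ℝ × ℝ => f p.1) (hf.comp (by fun_prop : Continuous fun p : (ℝ × ℝ) × ℝ => (p.1.1, p.2)))
    continuous_snd

theorem continuous_integral_right (hf : Continuous (uncurry f)) (a : ℝ) :
    Continuous (uncurry fun x y => ∫ s in a..x, f s y) :=
  intervalIntegral.continuous_parametric_intervalIntegral_of_continuous
    (f := fun (p : ℝ × ℝ) s => f s p.2)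
    (hf.comp (by fun_prop : Continuous fun p : (ℝ × ℝ) × ℝ => (p.2, p.1.2)))
    continuous_fst

theorem hasDerivAt_integral_diagonal (hf : Continuous (uncurry f))
    (hf₁ : Continuous (uncurry f₁)) (h₁ : ∀ x y, HasDerivAt (fun x' => f x' y) (f₁ x y) x)
    (x : ℝ) :
    HasDerivAt (fun x' => ∫ s in (0 : ℝ)..x', f x' s) (f x x + ∫ s in (0 : ℝ)..x, f₁ x s) x := by
  have cf : ∀ x, Continuous (f x) := fun x => hf.comp (Continuous.prodMk_right x)
  have := hasDerivAt_comp_of_partial (f := fun x y => ∫ s in (0 : ℝ)..y, f x s)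
    (f₁ := fun x y => ∫ s in (0 : ℝ)..y, f₁ x s) (f₂ := f)
    (fun x y => hasDerivAt_integral_of_continuous hf hf₁ h₁ 0 y x)
    (fun x y => (cf x).integral_hasStrictDerivAt 0 y |>.hasDerivAt)
    (continuous_integral_left hf₁ 0) hf (hasDerivAt_id x) (hasDerivAt_id x)
  simpa [add_comm] using! this

theorem norm_integral_le_pow_succ {g : ℝ → ℂ} {C u : ℝ} {n : ℕ}
    (hg : ∀ α ∈ uIoc 0 u, ‖g α‖ ≤ C * |α| ^ n) :
    ‖∫ α in (0 : ℝ)..u, g α‖ ≤ C * (|u| ^ (n + 1) / (n + 1)) := by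
  rw [intervalIntegral.norm_integral_eq_norm_integral_uIoc]
  have e := integral_pow_abs_sub_uIoc (a := 0) (b := u) (n := n)
  simp only [sub_zero] at e
  rw [← e, ← integral_const_mul]
  refine norm_integral_le_of_norm_le ?_ ?_
  · exact ((by fun_prop : Continuous fun α : ℝ => C * |α| ^ n).intervalIntegrable 0 u).def'
  · exact (ae_restrict_iff' measurableSet_uIoc).2 (Eventually.of_forall hg)

end Calculus

open BoundedContinuousFunction

noncomputable section

/-! ### The Goursat problem -/

section Goursat

variable {q : ℝ → ℂ} {a Q : ℝ}

/-- The right-hand side of the Volterra equation equivalent to the Goursat problem. -/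
def volterraMap (q ρ : ℝ → ℂ) (G : ℝ → ℝ → ℂ) (u v : ℝ) : ℂ :=
  ρ u + ∫ α in (0 : ℝ)..u, ∫ β in (0 : ℝ)..v, q (α + β) * G α β

theorem continuous_potential_mul (hq : Continuous q) {G : ℝ → ℝ → ℂ}
    (hG : Continuous (uncurry G)) : Continuous (uncurry fun α β => q (α + β) * G α β) :=
  (hq.comp (continuous_fst.add continuous_snd)).mul hG

theorem continuous_volterraMap (hq : Continuous q) {ρ : ℝ → ℂ} (hρ : Continuous ρ)
    {G : ℝ → ℝ → ℂ} (hG : Continuous (uncurry G)) : Continuous (uncurry (volterraMap q ρ G)) :=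
  (hρ.comp continuous_fst).add <| continuous_integral_right
    (f := fun α v => ∫ β in (0 : ℝ)..v, q (α + β) * G α β)
    (continuous_integral_left (continuous_potential_mul hq hG) 0) 0

/-- `volterraMap` on the square `[-a, a]²`, extended to the plane by projecting onto the square. -/
def clampedVolterraMap (ha : -a ≤ a) (hq : Continuous q) {ρ : ℝ → ℂ} (hρ : Continuous ρ)
    (G : ℝ × ℝ →ᵇ ℂ) : ℝ × ℝ →ᵇ ℂ :=
  (mkOfCompact (⟨fun p : Icc (-a) a × Icc (-a) a => volterraMap q ρ (curry G) p.1 p.2,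
    (continuous_volterraMap hq hρ (G := curry G) G.continuous).comp
      (by fun_prop : Continuous fun p : Icc (-a) a × Icc (-a) a => ((p.1 : ℝ), (p.2 : ℝ)))⟩ :
      C(Icc (-a) a × Icc (-a) a, ℂ))).compContinuous
    ⟨fun p : ℝ × ℝ => (projIcc (-a) a ha p.1, projIcc (-a) a ha p.2),
      (continuous_projIcc.comp continuous_fst).prodMk (continuous_projIcc.comp continuous_snd)⟩

theorem clampedVolterraMap_apply (ha : -a ≤ a) (hq : Continuous q) {ρ : ℝ → ℂ}
    (hρ : Continuous ρ) (G : ℝ × ℝ →ᵇ ℂ) (p : ℝ × ℝ) :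
    clampedVolterraMap ha hq hρ G p =
      volterraMap q ρ (curry G) (projIcc (-a) a ha p.1) (projIcc (-a) a ha p.2) := rfl

theorem abs_le_of_mem_uIoc_zero {x y : ℝ} (h : x ∈ uIoc 0 y) : |x| ≤ |y| := by
  have := abs_sub_left_of_mem_uIcc (uIoc_subset_uIcc h)
  simpa using this

theorem norm_clampedVolterraMap_iterate_sub_le (ha : -a ≤ a) (hq : Continuous q)
    (hQ : ∀ x, ‖q x‖ ≤ Q) {ρ : ℝ → ℂ} (hρ : Continuous ρ) (G₁ G₂ : ℝ × ℝ →ᵇ ℂ) (n : ℕ)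
    (p : ℝ × ℝ) :
    ‖(clampedVolterraMap ha hq hρ)^[n] G₁ p - (clampedVolterraMap ha hq hρ)^[n] G₂ p‖ ≤
      dist G₁ G₂ * (Q * a) ^ n / n.factorial * |(projIcc (-a) a ha p.1 : ℝ)| ^ n := by
  have hQ0 : 0 ≤ Q := (norm_nonneg _).trans (hQ 0)
  have ha0 : 0 ≤ a := by linarith
  induction n generalizing p with
  | zero => simpa [dist_eq_norm] using BoundedContinuousFunction.dist_coe_le_dist (f := G₁) (g := G₂) p
  | succ n ih =>
    set F₁ := (clampedVolterraMap ha hq hρ)^[n] G₁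
    set F₂ := (clampedVolterraMap ha hq hρ)^[n] G₂
    rw [iterate_succ_apply', iterate_succ_apply', clampedVolterraMap_apply,
      clampedVolterraMap_apply]
    set u := projIcc (-a) a ha p.1
    set v := projIcc (-a) a ha p.2
    have c : ∀ F : ℝ × ℝ →ᵇ ℂ, Continuous (uncurry fun α β => q (α + β) * curry F α β) :=
      fun F => continuous_potential_mul hq F.continuous
    have ci : ∀ F : ℝ × ℝ →ᵇ ℂ,
        Continuous fun α => ∫ β in (0 : ℝ)..v, q (α + β) * curry F α β := fun F =>
      (continuous_integral_left (c F) 0).comp (Continuous.prodMk_left (v : ℝ))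
    unfold volterraMap
    rw [add_sub_add_left_eq_sub, ← intervalIntegral.integral_sub
      ((ci F₁).intervalIntegrable _ _) ((ci F₂).intervalIntegrable _ _)]
    have hv : |(v : ℝ)| ≤ a := abs_le.2 v.2
    have hu : |(u : ℝ)| ≤ a := abs_le.2 u.2
    refine (norm_integral_le_pow_succ (n := n)
      (C := dist G₁ G₂ * (Q * a) ^ (n + 1) / n.factorial) fun α hα => ?_).trans (le_of_eq ?_)
    · have hαa : |α| ≤ a := (abs_le_of_mem_uIoc_zero hα).trans hu
      have cα : ∀ F : ℝ × ℝ →ᵇ ℂ, Continuous fun β => q (α + β) * curry F α β := fun F =>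
        (c F).comp (Continuous.prodMk_right α)
      rw [← intervalIntegral.integral_sub ((cα F₁).intervalIntegrable _ _)
        ((cα F₂).intervalIntegrable _ _)]
      refine (intervalIntegral.norm_integral_le_of_norm_le_const
        (C := Q * (dist G₁ G₂ * (Q * a) ^ n / n.factorial * |α| ^ n)) fun β _ => ?_).trans ?_
      · rw [← mul_sub, norm_mul]
        have := ih (α, β)
        rw [projIcc_of_mem ha (abs_le.1 hαa)] at this
        exact mul_le_mul (hQ _) this (norm_nonneg _) hQ0
      · rw [sub_zero]
        refine (mul_le_mul_of_nonneg_left hv (by positivity)).trans (le_of_eq ?_)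
        ring
    · rw [Nat.factorial_succ]
      push_cast
      field_simp

theorem exists_volterra_solution (ha : 0 ≤ a) (hq : Continuous q) (hQ : ∀ x, ‖q x‖ ≤ Q)
    {ρ : ℝ → ℂ} (hρ : Continuous ρ) :
    ∃ G : ℝ → ℝ → ℂ, Continuous (uncurry G) ∧
      ∀ u ∈ Icc (-a) a, ∀ v ∈ Icc (-a) a, G u v = volterraMap q ρ G u v := by
  have ha' : -a ≤ a := by linarith
  have hQ0 : 0 ≤ Q := (norm_nonneg _).trans (hQ 0)
  obtain ⟨n, hn⟩ : ∃ n : ℕ, (Q * a * a) ^ n / n.factorial < 1 :=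
    ((FloorSemiring.tendsto_pow_div_factorial_atTop (Q * a * a)).eventually_lt_const
      one_pos).exists
  have hn0 : 0 ≤ (Q * a * a) ^ n / n.factorial := by positivity
  have hc : ContractingWith ⟨_, hn0⟩ (clampedVolterraMap ha' hq hρ)^[n] := by
    refine ⟨by exact_mod_cast hn, LipschitzWith.of_dist_le_mul fun G₁ G₂ => ?_⟩
    refine (dist_le (by positivity)).2 fun p => ?_
    rw [dist_eq_norm]
    refine (norm_clampedVolterraMap_iterate_sub_le ha' hq hQ hρ G₁ G₂ n p).trans ?_
    have hu : |(projIcc (-a) a ha' p.1 : ℝ)| ≤ a := abs_le.2 (projIcc (-a) a ha' p.1).2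
    refine (mul_le_mul_of_nonneg_left (pow_le_pow_left₀ (abs_nonneg _) hu n)
      (by positivity)).trans (le_of_eq ?_)
    change _ = (Q * a * a) ^ n / n.factorial * dist G₁ G₂
    ring
  refine ⟨curry hc.fixedPoint, (hc.fixedPoint).continuous, fun u hu v hv => ?_⟩
  have := congrArg (fun F : ℝ × ℝ →ᵇ ℂ => F (u, v)) hc.isFixedPt_fixedPoint_iterate
  simp only [clampedVolterraMap_apply, projIcc_of_mem ha' hu, projIcc_of_mem ha' hv] at this
  exact this.symm

/-- A solution of the Goursat problem defined on the whole plane together with its derivatives;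
it satisfies the differential equation on the square `[-a, a]²`, where `G` agrees with `H`. -/
structure GlobalGoursat (a : ℝ) (q : ℝ → ℂ) (H H₁ H₂ G : ℝ → ℝ → ℂ) : Prop where
  cont : Continuous (uncurry H)
  cont₁ : Continuous (uncurry H₁)
  cont₂ : Continuous (uncurry H₂)
  contG : Continuous (uncurry G)
  deriv₁ : ∀ u v, HasDerivAt (fun u' => H u' v) (H₁ u v) u
  deriv₂ : ∀ u v, HasDerivAt (fun v' => H u v') (H₂ u v) v
  deriv₂₁ : ∀ u v, HasDerivAt (fun u' => H₂ u' v) (q (u + v) * G u v) u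
  eq_on : ∀ u ∈ Icc (-a) a, ∀ v ∈ Icc (-a) a, G u v = H u v
  left_boundary : ∀ u, H u 0 = (1 / 2 : ℂ) * ∫ s in (0 : ℝ)..u, q s
  right_boundary : ∀ v, H 0 v = 0
  right_boundary' : ∀ v, H₂ 0 v = 0

theorem exists_globalGoursat (ha : 0 ≤ a) (hq : Continuous q) (hQ : ∀ x, ‖q x‖ ≤ Q) :
    ∃ H H₁ H₂ G, GlobalGoursat a q H H₁ H₂ G := by
  have hρ : ∀ u, HasDerivAt (fun u => (1 / 2 : ℂ) * ∫ s in (0 : ℝ)..u, q s) (1 / 2 * q u) u :=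
    fun u => (hq.integral_hasStrictDerivAt 0 u).hasDerivAt.const_mul _
  have cρ : Continuous fun u : ℝ => (1 / 2 : ℂ) * ∫ s in (0 : ℝ)..u, q s :=
    continuous_iff_continuousAt.2 fun u => (hρ u).continuousAt
  obtain ⟨G, hG, e⟩ := exists_volterra_solution ha hq hQ cρ
  have c := continuous_potential_mul hq hG
  have cl := continuous_integral_left c 0
  have cr := continuous_integral_right c 0
  have cH := continuous_volterraMap hq cρ hG
  have d₁ : ∀ u v, HasDerivAt
      (fun u' => volterraMap q (fun u => (1 / 2 : ℂ) * ∫ s in (0 : ℝ)..u, q s) G u' v)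
      (1 / 2 * q u + ∫ β in (0 : ℝ)..v, q (u + β) * G u β) u := fun u v =>
    (hρ u).add ((cl.comp (Continuous.prodMk_left v)).integral_hasStrictDerivAt 0 u).hasDerivAt
  have d₂ : ∀ u v, HasDerivAt (fun v' => ∫ α in (0 : ℝ)..u, ∫ β in (0 : ℝ)..v',
      q (α + β) * G α β) (∫ α in (0 : ℝ)..u, q (α + v) * G α v) v := fun u v =>
    hasDerivAt_integral_of_continuous (f := fun v α => ∫ β in (0 : ℝ)..v, q (α + β) * G α β)
      (f₁ := fun v α => q (α + v) * G α v)
      (cl.comp continuous_swap) (c.comp continuous_swap)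
      (fun v α => ((c.comp (Continuous.prodMk_right α)).integral_hasStrictDerivAt 0 v).hasDerivAt)
      0 u v
  refine ⟨volterraMap q _ G, fun u v => 1 / 2 * q u + ∫ β in (0 : ℝ)..v, q (u + β) * G u β,
    fun u v => ∫ α in (0 : ℝ)..u, q (α + v) * G α v, G, cH, ?_, cr, hG, d₁,
    fun u v => (d₂ u v).const_add _, fun u v => ?_, e, fun u => ?_, fun v => ?_, fun v => ?_⟩
  · exact (continuous_const.mul (hq.comp continuous_fst)).add cl
  · exact ((c.comp (Continuous.prodMk_left v)).integral_hasStrictDerivAt 0 u).hasDerivAt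
  · simp [volterraMap]
  · simp [volterraMap]
  · simp

theorem GlobalGoursat.isGoursatSolution {p : ℝ → ℂ} {H H₁ H₂ G : ℝ → ℝ → ℂ}
    (g : GlobalGoursat a q H H₁ H₂ G) (hp : EqOn q p (Icc (-a) a)) (ha : 0 ≤ a) :
    IsGoursatSolution a p H where
  continuousOn := g.cont.continuousOn
  contDiffOn := (contDiff_one_of_partial g.deriv₁ g.deriv₂ g.cont₁ g.cont₂).contDiffOn
  mixed_deriv u v huv := by
    have e : (fun u' => deriv (fun v' => H u' v') v) = fun u' => H₂ u' v :=
      funext fun u' => (g.deriv₂ u' v).deriv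
    have hu : u ∈ Icc (-a) a := abs_le.1 (by linarith [abs_nonneg v])
    have hv : v ∈ Icc (-a) a := abs_le.1 (by linarith [abs_nonneg u])
    have huv' : u + v ∈ Icc (-a) a := abs_le.1 ((abs_add_le u v).trans huv.le)
    rw [e, ← g.eq_on u hu v hv, ← hp huv']
    exact g.deriv₂₁ u v
  left_boundary u hu := by
    rw [g.left_boundary]
    congr 1
    refine intervalIntegral.integral_congr fun s hs => hp ?_
    exact uIcc_subset_Icc (by simpa using ha) hu hs
  right_boundary v _ := g.right_boundary v

theorem IsGoursatSolution.eq_of_mem_openDiamond {H H' : ℝ → ℝ → ℂ}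
    (hq : ContinuousOn q (Icc (-a) a)) (h : IsGoursatSolution a q H)
    (h' : IsGoursatSolution a q H') {u v : ℝ} (huv : |u| + |v| < a) : H u v = H' u v := by
  set D : ℝ → ℝ → ℂ := fun u v => H u v - H' u v with hD
  have hcD : ContinuousOn (fun p : ℝ × ℝ => D p.1 p.2) (closedDiamond a) :=
    h.continuousOn.sub h'.continuousOn
  have hopen : IsOpen (openDiamond a) :=
    isOpen_lt (by fun_prop : Continuous fun p : ℝ × ℝ => |p.1| + |p.2|) continuous_const
  have hdiff : ∀ {F : ℝ → ℝ → ℂ}, IsGoursatSolution a q F → ∀ u v : ℝ, |u| + |v| < a →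
      HasDerivAt (fun v' => F u v') (deriv (fun v' => F u v') v) v := fun hF u v huv =>
    ((hF.contDiffOn.differentiableOn (by simp)).differentiableAt
      (hopen.mem_nhds (x := (u, v)) huv) |>.comp v
        (by fun_prop : DifferentiableAt ℝ (fun v' : ℝ => (u, v')) v)).hasDerivAt
  set D₂ : ℝ → ℝ → ℂ := fun u v => deriv (fun v' => H u v') v - deriv (fun v' => H' u v') v
  have hd : ∀ u v : ℝ, |u| + |v| < a → HasDerivAt (fun v' => D u v') (D₂ u v) v :=
    fun u v huv => (hdiff h u v huv).sub (hdiff h' u v huv)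
  have hm : ∀ u v : ℝ, |u| + |v| < a →
      HasDerivAt (fun u' => D₂ u' v) (q (u + v) * D u v) u := fun u v huv => by
    rw [hD, mul_sub]
    exact (h.mixed_deriv u v huv).sub (h'.mixed_deriv u v huv)
  have hzero : ∀ v : ℝ, |v| < a → D₂ 0 v = 0 := fun v hv => by
    have : (fun v' => D 0 v') =ᶠ[𝓝 v] fun _ => 0 := by
      filter_upwards [(isOpen_lt continuous_abs continuous_const).mem_nhds hv] with w hw
      have hw' : w ∈ Icc (-a) a := abs_le.1 (le_of_lt hw)
      simp [hD, h.right_boundary w hw', h'.right_boundary w hw']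
    exact (hd 0 v (by simpa using hv)).unique ((hasDerivAt_const v (0 : ℂ)).congr_of_eventuallyEq this)
  have hleft : ∀ u : ℝ, |u| < a → D u 0 = 0 := fun u hu => by
    have hu' : u ∈ Icc (-a) a := abs_le.1 hu.le
    simp [hD, h.left_boundary u hu', h'.left_boundary u hu']
  have hcompact : IsCompact (closedDiamond a) := by
    refine (isCompact_Icc (a := ((-a, -a) : ℝ × ℝ)) (b := (a, a))).of_isClosed_subset
      (isClosed_le (by fun_prop : Continuous fun p : ℝ × ℝ => |p.1| + |p.2|) continuous_const)
      fun p (hp : |p.1| + |p.2| ≤ a) => ?_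
    have h1 := abs_le.1 (show |p.1| ≤ a by linarith [abs_nonneg p.2])
    have h2 := abs_le.1 (show |p.2| ≤ a by linarith [abs_nonneg p.1])
    exact ⟨⟨h1.1, h2.1⟩, ⟨h1.2, h2.2⟩⟩
  obtain ⟨M, hM⟩ := hcompact.exists_bound_of_continuousOn hcD
  obtain ⟨Q, hQ⟩ := isCompact_Icc.exists_bound_of_continuousOn hq
  have ha : 0 ≤ a := by linarith [abs_nonneg u, abs_nonneg v]
  have hQ0 : 0 ≤ Q := (norm_nonneg _).trans (hQ 0 (by simpa using ha))
  have hM0 : 0 ≤ M := (norm_nonneg _).trans (hM (0, 0) (by simpa [closedDiamond] using ha))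
  have key : ∀ n : ℕ, ∀ u v : ℝ, |u| + |v| < a →
      ‖D u v‖ ≤ M * (Q * a) ^ n / n.factorial * |u| ^ n := by
    intro n
    induction n with
    | zero => intro u v huv; simpa using hM (u, v) huv.le
    | succ n ih =>
      intro u v huv
      have hsub : ∀ α ∈ uIcc 0 u, ∀ β : ℝ, |β| ≤ |v| → |α| + |β| < a := fun α hα β hβ => by
        have := abs_sub_left_of_mem_uIcc hα
        simp only [sub_zero] at this
        linarith
      have hD₂ : ∀ β : ℝ, |β| ≤ |v| → ‖D₂ u β‖ ≤
          Q * (M * (Q * a) ^ n / n.factorial) * (|u| ^ (n + 1) / (n + 1)) := fun β hβ => by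
        have hqm : ∀ α ∈ uIcc 0 u, α + β ∈ Icc (-a) a := fun α hα =>
          abs_le.1 ((abs_add_le α β).trans (hsub α hα β hβ).le)
        have hcont : ContinuousOn (fun α => q (α + β) * D α β) (uIcc 0 u) :=
          (hq.comp (by fun_prop) hqm).mul
            (hcD.comp (f := fun α : ℝ => (α, β)) (by fun_prop) fun α hα => (hsub α hα β hβ).le)
        have := intervalIntegral.integral_eq_sub_of_hasDerivAt
          (fun α hα => hm α β (hsub α hα β hβ)) hcont.intervalIntegrable
        rw [hzero β (by linarith [abs_nonneg u]), sub_zero] at this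
        rw [← this]
        refine norm_integral_le_pow_succ fun α hα => ?_
        have hα' := uIoc_subset_uIcc hα
        rw [norm_mul, mul_assoc]
        exact mul_le_mul (hQ _ (hqm α hα')) (ih α β (hsub α hα' β hβ)) (norm_nonneg _) hQ0
      have hmv := (convex_uIcc 0 v).norm_image_sub_le_of_norm_hasDerivWithin_le
        (f := fun v' => D u v') (f' := D₂ u)
        (fun β hβ => (hd u β (hsub u right_mem_uIcc β (by
          simpa using abs_sub_left_of_mem_uIcc hβ))).hasDerivWithinAt)
        (fun β hβ => hD₂ β (by simpa using abs_sub_left_of_mem_uIcc hβ))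
        left_mem_uIcc right_mem_uIcc
      simp only [hleft u (by linarith [abs_nonneg v]), sub_zero, Real.norm_eq_abs] at hmv
      refine hmv.trans ((mul_le_mul_of_nonneg_left
        (show |v| ≤ a by linarith [abs_nonneg u]) (by positivity)).trans (le_of_eq ?_))
      rw [Nat.factorial_succ]
      push_cast
      field_simp
      ring
  have hlim : Tendsto (fun n : ℕ => M * ((Q * a * |u|) ^ n / n.factorial)) atTop (𝓝 0) := by
    simpa using (FloorSemiring.tendsto_pow_div_factorial_atTop (Q * a * |u|)).const_mul M
  have hle : ‖D u v‖ ≤ 0 := ge_of_tendsto' hlim fun n =>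
    (key n u v huv).trans (le_of_eq (by rw [mul_pow]; ring))
  exact sub_eq_zero.1 (norm_le_zero_iff.1 hle)

theorem IsGoursatSolution.eq_of_mem_closedDiamond {H H' : ℝ → ℝ → ℂ} (ha : 0 < a)
    (hq : ContinuousOn q (Icc (-a) a)) (h : IsGoursatSolution a q H)
    (h' : IsGoursatSolution a q H') {u v : ℝ} (huv : |u| + |v| ≤ a) : H u v = H' u v := by
  have hsub : closedDiamond a ⊆ closure (openDiamond a) := fun p (hp : |p.1| + |p.2| ≤ a) => by
    have hlim : Tendsto (fun t : ℝ => t • p) (𝓝[Iio 1] 1) (𝓝 p) := by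
      have : Tendsto (fun t : ℝ => t • p) (𝓝 1) (𝓝 ((1 : ℝ) • p)) :=
        (by fun_prop : Continuous fun t : ℝ => t • p).tendsto 1
      rw [one_smul] at this
      exact this.mono_left nhdsWithin_le_nhds
    refine mem_closure_of_tendsto hlim ?_
    filter_upwards [Ioo_mem_nhdsLT (show (0 : ℝ) < 1 by norm_num)] with t ht
    simp only [openDiamond, mem_ofPred_eq, Prod.smul_fst, Prod.smul_snd, smul_eq_mul, abs_mul,
      abs_of_pos ht.1, ← mul_add]
    calc t * (|p.1| + |p.2|) ≤ t * a := mul_le_mul_of_nonneg_left hp ht.1.le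
      _ < a := by nlinarith [ht.2]
  exact EqOn.of_subset_closure (s := openDiamond a) (t := closedDiamond a)
    (f := fun p : ℝ × ℝ => H p.1 p.2) (g := fun p => H' p.1 p.2)
    (fun p hp => h.eq_of_mem_openDiamond hq h' hp) h.continuousOn h'.continuousOn
    (fun p (hp : |p.1| + |p.2| < a) => hp.le) hsub (show (u, v) ∈ closedDiamond a from huv)

end Goursat

end

/-! ### Solutions of the Schrödinger equation on an interval -/

section Schrodinger

variable {a : ℝ} {q : ℝ → ℂ} {ω : ℂ}

theorem isSolution_of_hasDerivWithinAt (ha : 0 < a) (hq : ContinuousOn q (Icc (-a) a))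
    {u u' : ℝ → ℂ} (h₁ : ∀ x ∈ Icc (-a) a, HasDerivWithinAt u (u' x) (Icc (-a) a) x)
    (h₂ : ∀ x ∈ Icc (-a) a,
      HasDerivWithinAt u' (q x * u x - ω ^ 2 * u x) (Icc (-a) a) x) :
    IsSolution a q ω u := by
  have hs : UniqueDiffOn ℝ (Icc (-a) a) := uniqueDiffOn_Icc (by linarith)
  have e₁ : EqOn (derivWithin u (Icc (-a) a)) u' (Icc (-a) a) := fun x hx =>
    (h₁ x hx).derivWithin (hs x hx)
  have e₂ : EqOn (derivWithin u' (Icc (-a) a)) (fun x => q x * u x - ω ^ 2 * u x)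
      (Icc (-a) a) := fun x hx => (h₂ x hx).derivWithin (hs x hx)
  have hc : ContinuousOn u (Icc (-a) a) := fun x hx => (h₁ x hx).continuousWithinAt
  refine ⟨?_, fun x hx => ?_⟩
  · rw [show (2 : WithTop ℕ∞) = 1 + 1 by norm_num, contDiffOn_succ_iff_derivWithin hs]
    refine ⟨fun x hx => (h₁ x hx).differentiableWithinAt, by simp, ContDiffOn.congr ?_ e₁⟩
    rw [show (1 : WithTop ℕ∞) = 0 + 1 by norm_num, contDiffOn_succ_iff_derivWithin hs]
    refine ⟨fun x hx => (h₂ x hx).differentiableWithinAt, by simp, ContDiffOn.congr ?_ e₂⟩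
    exact contDiffOn_zero.2 ((hq.mul hc).sub (continuousOn_const.mul hc))
  · rw [iteratedDerivWithin_succ, iteratedDerivWithin_one, derivWithin_congr e₁ (e₁ hx), e₂ hx]
    ring

theorem IsSolution.hasDerivAt {u : ℝ → ℂ} (h : IsSolution a q ω u) {x : ℝ}
    (hx : x ∈ Ioo (-a) a) :
    HasDerivAt u (derivWithin u (Icc (-a) a) x) x ∧
      HasDerivAt (derivWithin u (Icc (-a) a)) (q x * u x - ω ^ 2 * u x) x := by
  have hs : UniqueDiffOn ℝ (Icc (-a) a) := uniqueDiffOn_Icc (hx.1.trans hx.2)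
  have hn := Icc_mem_nhds hx.1 hx.2
  have hx' := Ioo_subset_Icc_self hx
  refine ⟨((h.1.differentiableOn (by simp)) x hx').hasDerivWithinAt.hasDerivAt hn, ?_⟩
  have h2 := h.2 x hx'
  rw [iteratedDerivWithin_succ, iteratedDerivWithin_one] at h2
  rw [show q x * u x - ω ^ 2 * u x = derivWithin (derivWithin u (Icc (-a) a)) (Icc (-a) a) x by
    linear_combination -h2]
  exact (((h.1.derivWithin hs (m := 1) (by norm_num)).differentiableOn (by simp)) x
    hx').hasDerivWithinAt.hasDerivAt hn

theorem IsSolution.eqOn (ha : 0 < a) (hq : ContinuousOn q (Icc (-a) a)) {u₁ u₂ : ℝ → ℂ}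
    (h₁ : IsSolution a q ω u₁) (h₂ : IsSolution a q ω u₂) (h₀ : u₁ 0 = u₂ 0)
    (h₀' : deriv u₁ 0 = deriv u₂ 0) : EqOn u₁ u₂ (Icc (-a) a) := by
  obtain ⟨Q, hQ⟩ := isCompact_Icc.exists_bound_of_continuousOn hq
  have h0 : (0 : ℝ) ∈ Ioo (-a) a := ⟨by linarith, ha⟩
  have hs : UniqueDiffOn ℝ (Icc (-a) a) := uniqueDiffOn_Icc (by linarith)
  have hQ0 : 0 ≤ Q := (norm_nonneg _).trans (hQ 0 (Ioo_subset_Icc_self h0))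
  set F : (ℝ → ℂ) → ℝ → ℂ × ℂ := fun u t => (u t, derivWithin u (Icc (-a) a) t)
  have hc : ∀ {u}, IsSolution a q ω u → ContinuousOn (F u) (Icc (-a) a) := fun h =>
    h.1.continuousOn.prodMk ((h.1.continuousOn_derivWithin hs (by simp)))
  have hd : ∀ {u}, IsSolution a q ω u → ∀ t ∈ Ioo (-a) a,
      HasDerivAt (F u) ((F u t).2, (q t - ω ^ 2) * (F u t).1) t := fun h t ht => by
    rw [sub_mul]
    exact (h.hasDerivAt ht).1.prodMk (h.hasDerivAt ht).2
  have hL : ∀ t ∈ Ioo (-a) a, LipschitzOnWith (Real.toNNReal (1 + Q + ‖ω‖ ^ 2))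
      (fun p : ℂ × ℂ => (p.2, (q t - ω ^ 2) * p.1)) univ := fun t ht => by
    refine LipschitzOnWith.of_dist_le_mul fun p _ p' _ => ?_
    have hq' : ‖q t - ω ^ 2‖ ≤ Q + ‖ω‖ ^ 2 := (norm_sub_le _ _).trans
      (by rw [norm_pow]; linarith [hQ t (Ioo_subset_Icc_self ht)])
    have d₁ : ‖p.1 - p'.1‖ ≤ ‖p - p'‖ := norm_fst_le (p - p')
    have d₂ : ‖p.2 - p'.2‖ ≤ ‖p - p'‖ := norm_snd_le (p - p')
    rw [Real.coe_toNNReal _ (by positivity), dist_eq_norm, dist_eq_norm, Prod.norm_def]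
    refine max_le ?_ ?_
    · refine d₂.trans (le_mul_of_one_le_left (norm_nonneg _) ?_)
      linarith [sq_nonneg ‖ω‖]
    · change ‖(q t - ω ^ 2) * p.1 - (q t - ω ^ 2) * p'.1‖ ≤ _
      rw [← mul_sub, norm_mul]
      exact mul_le_mul (by linarith) d₁ (norm_nonneg _) (by positivity)
  have := ODE_solution_unique_of_mem_Icc (v := fun t p => (p.2, (q t - ω ^ 2) * p.1))
    (f := F u₁) (g := F u₂) hL h0 (hc h₁) (hd h₁) (fun _ _ => mem_univ _) (hc h₂) (hd h₂)
    (fun _ _ => mem_univ _) (Prod.ext h₀ (by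
      rwa [(h₁.hasDerivAt h0).1.deriv, (h₂.hasDerivAt h0).1.deriv] at h₀'))
  exact fun x hx => congrArg Prod.fst (this hx)

theorem IsSolution.congr {u₁ u₂ : ℝ → ℂ} (h : IsSolution a q ω u₁)
    (e : EqOn u₂ u₁ (Icc (-a) a)) : IsSolution a q ω u₂ :=
  ⟨h.1.congr e, fun x hx => by rw [iteratedDerivWithin_congr e hx, e hx]; exact h.2 x hx⟩

theorem IsSolution.congr_potential {p : ℝ → ℂ} {u : ℝ → ℂ} (h : IsSolution a q ω u)
    (e : EqOn p q (Icc (-a) a)) : IsSolution a p ω u :=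
  ⟨h.1, fun x hx => by rw [e hx]; exact h.2 x hx⟩

end Schrodinger

/-! ### The transmutation operator without the parameter -/

section Transmute

variable {a : ℝ} {q : ℝ → ℂ} {H H₁ H₂ G : ℝ → ℝ → ℂ} {y y' : ℝ → ℂ} {ω : ℂ}

theorem GlobalGoursat.hasDerivAt_transmute (g : GlobalGoursat a q H H₁ H₂ G)
    (hy : ∀ x, HasDerivAt y (y' x) x) (hy' : Continuous y') (x : ℝ) :
    HasDerivAt (fun x => ∫ s in (0 : ℝ)..x, H s (x - s) * y (2 * s - x))
      (H x 0 * y x + ∫ r in (0 : ℝ)..x, (H₂ (x - r) r * y (x - 2 * r) - H (x - r) r * y' (x - 2 * r)))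
      x := by
  have cy : Continuous y := continuous_iff_continuousAt.2 fun x => (hy x).continuousAt
  have e₁ : Continuous fun p : ℝ × ℝ => (p.2, p.1 - p.2) := by fun_prop
  have e₂ : Continuous fun p : ℝ × ℝ => 2 * p.2 - p.1 := by fun_prop
  have := hasDerivAt_integral_diagonal
    (f := fun x s => H s (x - s) * y (2 * s - x))
    (f₁ := fun x s => H₂ s (x - s) * y (2 * s - x) - H s (x - s) * y' (2 * s - x))
    ((g.cont.comp e₁).mul (cy.comp e₂))
    (((g.cont₂.comp e₁).mul (cy.comp e₂)).sub ((g.cont.comp e₁).mul (hy'.comp e₂)))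
    (fun x s => by
      have a₁ := (g.deriv₂ s (x - s)).scomp x ((hasDerivAt_id x).sub_const s)
      have a₂ := (hy (2 * s - x)).scomp x ((hasDerivAt_id x).const_sub (2 * s))
      refine (a₁.mul a₂).congr_deriv ?_
      simp
      ring) x
  refine this.congr_deriv ?_
  congr 1
  · simp [two_mul]
  · have := intervalIntegral.integral_comp_sub_left (a := 0) (b := x)
      (fun s => H₂ s (x - s) * y (2 * s - x) - H s (x - s) * y' (2 * s - x)) x
    rw [sub_self, sub_zero] at this
    rw [← this]
    refine intervalIntegral.integral_congr fun r _ => ?_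
    simp only [sub_sub_cancel, show 2 * (x - r) - x = x - 2 * r by ring]

theorem GlobalGoursat.hasDerivAt_deriv_transmute (g : GlobalGoursat a q H H₁ H₂ G)
    (hq : Continuous q) (hy : ∀ x, HasDerivAt y (y' x) x)
    (hy' : ∀ x, HasDerivAt y' (-(ω ^ 2 * y x)) x) {x : ℝ} (hx : x ∈ Icc (-a) a) :
    HasDerivAt (fun x => H x 0 * y x +
        ∫ r in (0 : ℝ)..x, (H₂ (x - r) r * y (x - 2 * r) - H (x - r) r * y' (x - 2 * r)))
      (1 / 2 * q x * y x +
        (q x - ω ^ 2) * ∫ s in (0 : ℝ)..x, H s (x - s) * y (2 * s - x)) x := by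
  have cy : Continuous y := continuous_iff_continuousAt.2 fun x => (hy x).continuousAt
  have cy' : Continuous y' := continuous_iff_continuousAt.2 fun x => (hy' x).continuousAt
  have e₁ : Continuous fun p : ℝ × ℝ => (p.1 - p.2, p.2) := by fun_prop
  have e₂ : Continuous fun p : ℝ × ℝ => p.1 - 2 * p.2 := by fun_prop
  have d₀ : HasDerivAt (fun x => H x 0 * y x) (1 / 2 * q x * y x + H x 0 * y' x) x := by
    have : HasDerivAt (fun x => H x 0) (1 / 2 * q x) x := by
      simp only [g.left_boundary]
      exact (hq.integral_hasStrictDerivAt 0 x).hasDerivAt.const_mul _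
    exact this.mul (hy x)
  have cqG : Continuous (uncurry fun x r => q (x - r + r) * G (x - r) r) :=
    (continuous_potential_mul hq g.contG).comp e₁
  have cf₁ : Continuous (uncurry fun x r => q (x - r + r) * G (x - r) r * y (x - 2 * r)
      + H₂ (x - r) r * y' (x - 2 * r)
      - (H₁ (x - r) r * y' (x - 2 * r) - H (x - r) r * (ω ^ 2 * y (x - 2 * r)))) :=
    ((cqG.mul (cy.comp e₂)).add ((g.cont₂.comp e₁).mul (cy'.comp e₂))).sub
      (((g.cont₁.comp e₁).mul (cy'.comp e₂)).sub
        ((g.cont.comp e₁).mul ((continuous_const (y := ω ^ 2)).mul (cy.comp e₂))))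
  have d₁ := hasDerivAt_integral_diagonal
    (f := fun x r => H₂ (x - r) r * y (x - 2 * r) - H (x - r) r * y' (x - 2 * r))
    (f₁ := fun x r => q (x - r + r) * G (x - r) r * y (x - 2 * r) + H₂ (x - r) r * y' (x - 2 * r)
      - (H₁ (x - r) r * y' (x - 2 * r) - H (x - r) r * (ω ^ 2 * y (x - 2 * r))))
    (((g.cont₂.comp e₁).mul (cy.comp e₂)).sub ((g.cont.comp e₁).mul (cy'.comp e₂)))
    cf₁
    (fun x r => by
      have a₀ := (g.deriv₂₁ (x - r) r).scomp x ((hasDerivAt_id x).sub_const r)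
      have a₁ := (g.deriv₁ (x - r) r).scomp x ((hasDerivAt_id x).sub_const r)
      have a₂ := (hy (x - 2 * r)).scomp x ((hasDerivAt_id x).sub_const (2 * r))
      have a₃ := (hy' (x - 2 * r)).scomp x ((hasDerivAt_id x).sub_const (2 * r))
      refine ((a₀.mul a₂).sub (a₁.mul a₃)).congr_deriv ?_
      simp
      ring) x
  have c₁ : ∀ F : ℝ → ℝ → ℂ, Continuous (uncurry F) → Continuous fun r => F (x - r) r :=
    fun F hF => hF.comp (by fun_prop : Continuous fun r : ℝ => (x - r, r))
  have c₂ : ∀ z : ℝ → ℂ, Continuous z → Continuous fun r : ℝ => z (x - 2 * r) :=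
    fun z hz => hz.comp (by fun_prop)
  have ftc := intervalIntegral.integral_eq_sub_of_hasDerivAt (a := 0) (b := x)
    (f := fun r => H (x - r) r * y' (x - 2 * r))
    (f' := fun r => (H₂ (x - r) r - H₁ (x - r) r) * y' (x - 2 * r)
      + 2 * ω ^ 2 * (H (x - r) r * y (x - 2 * r)))
    (fun r _ => by
      have a₁ := hasDerivAt_comp_of_partial g.deriv₁ g.deriv₂ g.cont₁ g.cont₂
        ((hasDerivAt_id r).const_sub x) (hasDerivAt_id r)
      have a₃ := (hy' (x - 2 * r)).scomp r (((hasDerivAt_id r).const_mul 2).const_sub x)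
      refine (a₁.mul a₃).congr_deriv ?_
      simp
      ring)
    ((((c₁ _ g.cont₂).sub (c₁ _ g.cont₁)).mul (c₂ _ cy')).add
      (continuous_const.mul ((c₁ _ g.cont).mul (c₂ _ cy)))).continuousOn.intervalIntegrable
  have hrefl : ∫ s in (0 : ℝ)..x, H s (x - s) * y (2 * s - x) =
      ∫ r in (0 : ℝ)..x, H (x - r) r * y (x - 2 * r) := by
    have := intervalIntegral.integral_comp_sub_left (a := 0) (b := x)
      (fun s => H s (x - s) * y (2 * s - x)) x
    rw [sub_self, sub_zero] at this
    rw [← this]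
    refine intervalIntegral.integral_congr fun r _ => ?_
    simp only [sub_sub_cancel, show 2 * (x - r) - x = x - 2 * r by ring]
  have hI : ∫ r in (0 : ℝ)..x, (q (x - r + r) * G (x - r) r * y (x - 2 * r)
      + H₂ (x - r) r * y' (x - 2 * r)
      - (H₁ (x - r) r * y' (x - 2 * r) - H (x - r) r * (ω ^ 2 * y (x - 2 * r)))) =
      (∫ r in (0 : ℝ)..x, ((H₂ (x - r) r - H₁ (x - r) r) * y' (x - 2 * r)
        + 2 * ω ^ 2 * (H (x - r) r * y (x - 2 * r)))) +
      (q x - ω ^ 2) * ∫ r in (0 : ℝ)..x, H (x - r) r * y (x - 2 * r) := by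
    rw [← intervalIntegral.integral_const_mul, ← intervalIntegral.integral_add]
    · refine intervalIntegral.integral_congr fun r hr => ?_
      have hxa : |x| ≤ a := abs_le.2 hx
      have h1 : r ∈ Icc (-a) a := abs_le.1 (le_trans (by
        simpa using abs_sub_left_of_mem_uIcc hr) hxa)
      have h2 : x - r ∈ Icc (-a) a := abs_le.1 (le_trans (by
        simpa using abs_sub_right_of_mem_uIcc hr) hxa)
      simp only [sub_add_cancel, g.eq_on _ h2 _ h1]
      ring
    · exact ((((c₁ _ g.cont₂).sub (c₁ _ g.cont₁)).mul (c₂ _ cy')).add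
        (continuous_const.mul ((c₁ _ g.cont).mul (c₂ _ cy)))).intervalIntegrable _ _
    · exact (continuous_const.mul ((c₁ _ g.cont).mul (c₂ _ cy))).intervalIntegrable _ _
  rw [hI, ftc] at d₁
  refine (d₀.add d₁).congr_deriv ?_
  simp only [sub_self, sub_zero, g.right_boundary, g.right_boundary', mul_zero, hrefl]
  ring

theorem GlobalGoursat.isSolution_transmute (g : GlobalGoursat a q H H₁ H₂ G) (ha : 0 < a)
    (hq : Continuous q) (hy : ∀ x, HasDerivAt y (y' x) x)
    (hy' : ∀ x, HasDerivAt y' (-(ω ^ 2 * y x)) x) :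
    IsSolution a q ω (fun x => y x + 2 * ∫ s in (0 : ℝ)..x, H s (x - s) * y (2 * s - x)) ∧
    HasDerivAt (fun x => y x + 2 * ∫ s in (0 : ℝ)..x, H s (x - s) * y (2 * s - x)) (y' 0) 0 := by
  have cy' : Continuous y' := continuous_iff_continuousAt.2 fun x => (hy' x).continuousAt
  have d := fun x => (hy x).add ((g.hasDerivAt_transmute hy cy' x).const_mul 2)
  refine ⟨isSolution_of_hasDerivWithinAt ha hq.continuousOn
    (fun x _ => (d x).hasDerivWithinAt) fun x hx => ?_, ?_⟩
  · have := (hy' x).add ((g.hasDerivAt_deriv_transmute hq hy hy' hx).const_mul 2)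
    refine this.hasDerivWithinAt.congr_deriv ?_
    ring
  · simpa [g.left_boundary] using! d 0

end Transmute

/-! ### The kernel with a parameter -/

section Kernel

theorem integral_neg_self_swap {f g : ℝ → ℂ} (hf : Continuous f) (hg : Continuous g) (x : ℝ) :
    ∫ t in (-x)..x, f t * (g t - g (-t)) = ∫ t in (-x)..x, g t * (f t - f (-t)) := by
  have h := intervalIntegral.integral_comp_neg (a := -x) (b := x) (fun t => f t * g (-t))
  simp only [neg_neg] at h
  simp only [mul_sub]
  have i : ∀ {F : ℝ → ℂ}, Continuous F → IntervalIntegrable F volume (-x) x :=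
    fun hF => hF.intervalIntegrable _ _
  rw [intervalIntegral.integral_sub (i (by fun_prop)) (i (by fun_prop)),
    intervalIntegral.integral_sub (i (by fun_prop)) (i (by fun_prop)), ← h]
  simp only [mul_comm]

theorem integral_odd_part (k : ℝ → ℂ) (hk : Continuous k) (x : ℝ) :
    ∫ s in (-x)..x, (k s - k (-s)) = 0 := by
  have hk' : Continuous fun s => k (-s) := hk.comp continuous_neg
  have h := intervalIntegral.integral_comp_neg (a := -x) (b := x) k
  rw [neg_neg] at h
  rw [intervalIntegral.integral_sub (hk.intervalIntegrable _ _) (hk'.intervalIntegrable _ _), h,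
    sub_self]

theorem integral_kernel_parameter {k v V : ℝ → ℂ} (hk : Continuous k) (hv : Continuous v)
    (hV : ∀ t, HasDerivAt V (v t) t) (h : ℂ) (x : ℝ) :
    ∫ t in (-x)..x, (h / 2 + k t + h / 2 * ∫ s in t..x, (k s - k (-s))) * v t =
      h / 2 * (V x - V (-x)) + ∫ t in (-x)..x, k t * (v t + h / 2 * (V t - V (-t))) := by
  have cV : Continuous V := continuous_iff_continuousAt.2 fun x => (hV x).continuousAt
  have co : Continuous fun s => k s - k (-s) := hk.sub (hk.comp continuous_neg)
  have hP : ∀ t, HasDerivAt (fun t => ∫ s in t..x, (k s - k (-s))) (-(k t - k (-t))) t := fun t =>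
    intervalIntegral.integral_hasDerivAt_left (co.intervalIntegrable _ _)
      co.stronglyMeasurable.stronglyMeasurableAtFilter co.continuousAt
  have cP : Continuous fun t => ∫ s in t..x, (k s - k (-s)) :=
    continuous_iff_continuousAt.2 fun x => (hP x).continuousAt
  have parts := intervalIntegral.integral_mul_deriv_eq_deriv_mul (a := -x) (b := x)
    (fun t _ => hP t) (fun t _ => hV t) (co.neg.intervalIntegrable _ _) (hv.intervalIntegrable _ _)
  have hVint := intervalIntegral.integral_eq_sub_of_hasDerivAt (a := -x) (b := x)
    (fun t _ => hV t) (hv.intervalIntegrable _ _)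
  have swap := integral_neg_self_swap cV hk x
  rw [intervalIntegral.integral_same, integral_odd_part k hk x] at parts
  have e : ∀ t, (h / 2 + k t + h / 2 * ∫ s in t..x, (k s - k (-s))) * v t =
      h / 2 * v t + k t * v t + h / 2 * ((∫ s in t..x, (k s - k (-s))) * v t) := fun t => by ring
  have e' : ∀ t, k t * (v t + h / 2 * (V t - V (-t))) =
      k t * v t + h / 2 * (k t * (V t - V (-t))) := fun t => by ring
  have i : ∀ {F : ℝ → ℂ}, Continuous F → IntervalIntegrable F volume (-x) x :=
    fun hF => hF.intervalIntegrable _ _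
  simp only [e, e']
  rw [intervalIntegral.integral_add (i (by fun_prop)) (i (by fun_prop)),
    intervalIntegral.integral_add (i (by fun_prop)) (i (by fun_prop)),
    intervalIntegral.integral_add (i (by fun_prop)) (i (by fun_prop))]
  simp only [intervalIntegral.integral_const_mul]
  rw [hVint, parts, ← swap]
  simp only [neg_mul, intervalIntegral.integral_neg, mul_comm (V _)]
  ring

/-- On `[-a, a]` the operator `𝐓_h` only depends on the values of its argument on `[-a, a]` and of
the Goursat solution on the closed diamond. -/
theorem opT_eq {a : ℝ} {q : ℝ → ℂ} {H : ℝ → ℝ → ℂ} (hH : Continuous (uncurry H))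
    (e : ∀ u v : ℝ, |u| + |v| ≤ a → H u v = goursatH a q u v) {w v V : ℝ → ℂ}
    (hv : Continuous v) (hV : ∀ t, HasDerivAt V (v t) t) (hw : EqOn w v (Icc (-a) a)) (h : ℂ)
    {x : ℝ} (hx : x ∈ Icc (-a) a) :
    opT a q h w x = (v x + h / 2 * (V x - V (-x))) + 2 * ∫ s in (0 : ℝ)..x,
      H s (x - s) * (v (2 * s - x) + h / 2 * (V (2 * s - x) - V (-(2 * s - x)))) := by
  have hxa : |x| ≤ a := abs_le.2 hx
  set k : ℝ → ℂ := fun t => H ((x + t) / 2) ((x - t) / 2) with hk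
  have ck : Continuous k :=
    hH.comp (by fun_prop : Continuous fun t : ℝ => ((x + t) / 2, (x - t) / 2))
  have habs : ∀ {t}, t ∈ uIcc (-x) x → |t| ≤ |x| := fun {t} ht => by
    rcases le_total 0 x with h0 | h0
    · rw [uIcc_of_le (by linarith)] at ht
      rw [abs_of_nonneg h0]; exact abs_le.2 ht
    · rw [uIcc_of_ge (by linarith)] at ht
      rw [abs_of_nonpos h0]; exact abs_le.2 ⟨by linarith [ht.1], ht.2⟩
  have kK : ∀ {t}, |t| ≤ |x| → kernelK a q x t = k t := fun {t} ht => by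
    refine (e _ _ ?_).symm
    have h1 := abs_le.1 ht
    rcases abs_cases x with ⟨hx1, _⟩ | ⟨hx1, _⟩ <;>
    rcases abs_cases ((x + t) / 2) with ⟨h2, _⟩ | ⟨h2, _⟩ <;>
    rcases abs_cases ((x - t) / 2) with ⟨h3, _⟩ | ⟨h3, _⟩ <;> linarith [h1.1, h1.2]
  have step : opT a q h w x = v x +
      ∫ t in (-x)..x, (h / 2 + k t + h / 2 * ∫ s in t..x, (k s - k (-s))) * v t := by
    rw [opT, hw hx]
    congr 1
    refine intervalIntegral.integral_congr fun t ht => ?_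
    have hta := habs ht
    simp only [kernelKh]
    rw [hw (abs_le.1 (hta.trans hxa)), kK hta]
    congr 3
    refine intervalIntegral.integral_congr fun s hs => ?_
    have hs' : |s| ≤ |x| := habs (uIcc_subset_uIcc ht right_mem_uIcc hs)
    rw [kK hs', kK (by rwa [abs_neg])]
  have sub := intervalIntegral.integral_comp_mul_sub (a := 0) (b := x) (c := 2)
    (fun t => k t * (v t + h / 2 * (V t - V (-t)))) two_ne_zero x
  rw [mul_zero, zero_sub, show 2 * x - x = x by ring] at sub
  rw [step, integral_kernel_parameter ck hv hV h x, ← add_assoc]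
  congr 1
  have h2 : ∀ s : ℝ, k (2 * s - x) = H s (x - s) := fun s => by
    simp only [hk]; congr 1 <;> ring
  simp only [h2] at sub
  rw [sub, Complex.real_smul]
  push_cast
  ring

end Kernel

/-! ### Solutions of the free equation -/

section Free

/-- The solution `sin (ω x) / ω` of `y'' + ω² y = 0` with `y(0) = 0`, `y'(0) = 1`. -/
noncomputable def sinc (ω : ℂ) (x : ℝ) : ℂ := ∫ s in (0 : ℝ)..x, Complex.cos (ω * s)

theorem hasDerivAt_sinc (ω : ℂ) (x : ℝ) : HasDerivAt (sinc ω) (Complex.cos (ω * x)) x :=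
  ((by fun_prop : Continuous fun s : ℝ => Complex.cos (ω * s)).integral_hasStrictDerivAt
    0 x).hasDerivAt

theorem mul_sinc (ω : ℂ) (x : ℝ) : ω * sinc ω x = Complex.sin (ω * x) := by
  have := intervalIntegral.integral_eq_sub_of_hasDerivAt (a := 0) (b := x)
    (f := fun s : ℝ => Complex.sin (ω * s)) (f' := fun s : ℝ => ω * Complex.cos (ω * s))
    (fun s _ => by
      have := ((Complex.hasDerivAt_sin (ω * s)).comp (s : ℂ)
        ((hasDerivAt_id (s : ℂ)).const_mul ω)).comp_ofReal
      refine this.congr_deriv ?_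
      simp [mul_comm])
    ((by fun_prop : Continuous fun s : ℝ => ω * Complex.cos (ω * s)).intervalIntegrable _ _)
  rw [intervalIntegral.integral_const_mul] at this
  simpa [sinc] using this

theorem hasDerivAt_cos_mul (ω : ℂ) (x : ℝ) :
    HasDerivAt (fun x : ℝ => Complex.cos (ω * x)) (-(ω ^ 2 * sinc ω x)) x := by
  have := ((Complex.hasDerivAt_cos (ω * x)).comp (x : ℂ)
    ((hasDerivAt_id (x : ℂ)).const_mul ω)).comp_ofReal
  refine this.congr_deriv ?_
  linear_combination ω * mul_sinc ω x

theorem sinc_neg (ω : ℂ) (x : ℝ) : sinc ω (-x) = -sinc ω x := by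
  have := intervalIntegral.integral_comp_neg (a := 0) (b := x)
    (fun s : ℝ => Complex.cos (ω * s))
  simp only [Complex.ofReal_neg, mul_neg, Complex.cos_neg, neg_zero] at this
  rw [sinc, sinc, this, intervalIntegral.integral_symm]

theorem continuous_sinc (ω : ℂ) : Continuous (sinc ω) :=
  continuous_iff_continuousAt.2 fun x => (hasDerivAt_sinc ω x).continuousAt

theorem integral_sinc_neg (ω : ℂ) (x : ℝ) :
    ∫ s in (0 : ℝ)..(-x), sinc ω s = ∫ s in (0 : ℝ)..x, sinc ω s := by
  have := intervalIntegral.integral_comp_neg (a := 0) (b := x) (sinc ω)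
  simp only [sinc_neg, intervalIntegral.integral_neg, neg_zero] at this
  rw [intervalIntegral.integral_symm, ← this, neg_neg]

end Free

end Transmutation

open Transmutation

theorem mainTheorem10 (a : ℝ) (ha : 0 < a) (q : ℝ → ℂ) (hq : ContinuousOn q (Set.Icc (-a) a)) :
    -- the Goursat problem has exactly one solution, so the operators `𝐓_h` are well defined
    (Transmutation.IsGoursatSolution a q (Transmutation.goursatH a q) ∧
      ∀ H : ℝ → ℝ → ℂ, Transmutation.IsGoursatSolution a q H →
        ∀ u v : ℝ, |u| + |v| ≤ a → H u v = Transmutation.goursatH a q u v) ∧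
    -- `𝐓_h` maps `v` into the solution with the stated initial values
    ∀ (h ω : ℂ) (v : ℝ → ℂ), Transmutation.IsSolution a (fun _ => 0) ω v →
      Transmutation.IsSolution a q ω (Transmutation.opT a q h v) ∧
      Transmutation.opT a q h v 0 = v 0 ∧
      deriv (Transmutation.opT a q h v) 0 = deriv v 0 + h * v 0 ∧
      ∀ u : ℝ → ℂ, Transmutation.IsSolution a q ω u → u 0 = v 0 →
        deriv u 0 = deriv v 0 + h * v 0 →
        Set.EqOn u (Transmutation.opT a q h v) (Set.Icc (-a) a) := by
  have ha' : -a ≤ a := by linarith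
  have h0 : (0 : ℝ) ∈ Icc (-a) a := ⟨by linarith, ha.le⟩
  obtain ⟨Q, hQ⟩ := isCompact_Icc.exists_bound_of_continuousOn hq
  have cp : Continuous (IccExtend ha' ((Icc (-a) a).domRestrict q)) :=
    (continuousOn_iff_continuous_domRestrict.1 hq).Icc_extend'
  have hp : EqOn (IccExtend ha' ((Icc (-a) a).domRestrict q)) q (Icc (-a) a) :=
    fun x hx => IccExtend_of_mem ha' _ hx
  obtain ⟨H, H₁, H₂, G, g⟩ := exists_globalGoursat ha.le cp (Q := Q)
    fun x => hQ _ (projIcc (-a) a ha' x).2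
  have hH := g.isGoursatSolution hp ha.le
  have hsol : IsGoursatSolution a q (goursatH a q) := Classical.epsilon_spec ⟨H, hH⟩
  have huniq : ∀ H : ℝ → ℝ → ℂ, IsGoursatSolution a q H →
      ∀ u v : ℝ, |u| + |v| ≤ a → H u v = goursatH a q u v :=
    fun H hH u v huv => hH.eq_of_mem_closedDiamond ha hq hsol huv
  refine ⟨⟨hsol, huniq⟩, fun h ω v hv => ?_⟩
  set A := v 0
  set B := deriv v 0
  have dy : ∀ B : ℂ, ∀ x : ℝ, HasDerivAt (fun x : ℝ => A * Complex.cos (ω * x) + B * sinc ω x)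
      (-(ω ^ 2 * (A * sinc ω x)) + B * Complex.cos (ω * x)) x := fun B x => by
    refine (((hasDerivAt_cos_mul ω x).const_mul A).add
      ((hasDerivAt_sinc ω x).const_mul B)).congr_deriv ?_
    ring
  have dy' : ∀ B : ℂ, ∀ x : ℝ, HasDerivAt
      (fun x : ℝ => -(ω ^ 2 * (A * sinc ω x)) + B * Complex.cos (ω * x))
      (-(ω ^ 2 * (A * Complex.cos (ω * x) + B * sinc ω x))) x := fun B x => by
    refine ((((hasDerivAt_sinc ω x).const_mul A).const_mul (ω ^ 2)).neg.add
      ((hasDerivAt_cos_mul ω x).const_mul B)).congr_deriv ?_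
    ring
  have s0 : sinc ω 0 = 0 := by simp [sinc]
  have hfree : EqOn v (fun x : ℝ => A * Complex.cos (ω * x) + B * sinc ω x) (Icc (-a) a) := by
    refine hv.eqOn ha continuousOn_const (isSolution_of_hasDerivWithinAt ha continuousOn_const
      (fun x _ => (dy B x).hasDerivWithinAt) fun x _ => ?_) (by simp [s0, A]) ?_
    · simpa using! (dy' B x).hasDerivWithinAt
    · rw [(dy B 0).deriv]; simp [s0, B]
  have cy : Continuous fun x : ℝ => A * Complex.cos (ω * x) + B * sinc ω x :=
    continuous_iff_continuousAt.2 fun x => (dy B x).continuousAt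
  have hV : ∀ x : ℝ, HasDerivAt (fun x : ℝ => A * sinc ω x + B * ∫ s in (0 : ℝ)..x, sinc ω s)
      (A * Complex.cos (ω * x) + B * sinc ω x) x := fun x =>
    ((hasDerivAt_sinc ω x).const_mul A).add
      (((continuous_sinc ω).integral_hasStrictDerivAt 0 x).hasDerivAt.const_mul B)
  have hy : ∀ x : ℝ, A * Complex.cos (ω * x) + B * sinc ω x + h / 2 *
      (A * sinc ω x + B * (∫ s in (0 : ℝ)..x, sinc ω s) -
        (A * sinc ω (-x) + B * ∫ s in (0 : ℝ)..(-x), sinc ω s)) =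
      A * Complex.cos (ω * x) + (B + h * A) * sinc ω x := fun x => by
    rw [sinc_neg, integral_sinc_neg]; ring
  have hT : EqOn (opT a q h v) (fun x => (A * Complex.cos (ω * x) + (B + h * A) * sinc ω x) +
      2 * ∫ s in (0 : ℝ)..x, H s (x - s) * (A * Complex.cos (ω * (2 * s - x : ℝ)) +
        (B + h * A) * sinc ω (2 * s - x))) (Icc (-a) a) := fun x hx => by
    have := opT_eq g.cont (huniq H hH) cy hV hfree h hx
    simpa only [hy] using this
  obtain ⟨S, S'⟩ := g.isSolution_transmute ha cp (dy (B + h * A)) (dy' (B + h * A))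
  have hTsol : IsSolution a q ω (opT a q h v) := (S.congr_potential hp.symm).congr hT
  have hT0 : opT a q h v 0 = A := by rw [hT h0]; simp [s0]
  have hT1 : deriv (opT a q h v) 0 = B + h * A := by
    have e : opT a q h v =ᶠ[nhds 0] _ := hT.eventuallyEq_of_mem (Icc_mem_nhds (by linarith) ha)
    rw [(S'.congr_of_eventuallyEq e).deriv]
    simp [s0]
  exact ⟨hTsol, hT0, hT1, fun u hu hu0 hu1 =>
    hu.eqOn ha hq hTsol (hu0.trans hT0.symm) (hu1.trans hT1.symm)⟩
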